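/- Let $N \ge 1$, let $m$ be Lebesgue measure on $\mathbf{R}^N$, let $B = \{x \in \mathbf{R}^N : \|x\| < 1\}$ be the open Euclidean unit ball, and let $\sigma_N$ be the surface area of the unit sphere of $\mathbf{R}^N$, so that $\sigma_N/N = m(B)$. Let $(\nu_\alpha)_{\alpha \in A}$ be a net of locally finite Borel measures on $\mathbf{R}^N$, indexed by a nonempty directed set $A$, and suppose that each $\nu_\alpha$ is even, i.e. $\nu_\alpha(-U) = \nu_\alpha(U)$ for every Borel set $U$. Assume that there exist a real number $c$ and a dense set $F \subseteq \mathrm{SL}(N,\mathbf{R}) \times \mathbf{R}^+$, where $\mathbf{R}^+ = (0,\infty)$, such that $$\lim_{\alpha \in A} \nu_\alpha(tgB) = c\, t^N \frac{\sigma_N}{N} \qquad \text{for all } (g,t) \in F.$$ Then $$\lim_{\alpha \in A} \int_{\mathbf{R}^N} \psi(x)\, \nu_\alpha(dx) = c \int_{\mathbf{R}^N} \psi(x)\, m(dx)$$ for every (real- or complex-valued) continuous function $\psi$ with compact support on $\mathbf{R}^N$. -/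

import Mathlib

open MeasureTheory Filter Topology
open scoped Pointwise

/-- A measure on `ℝ^N` is even if `ν (-U) = ν U` for every Borel set `U`. -/
def IsEvenMeasure {N : ℕ} (ν : Measure (EuclideanSpace ℝ (Fin N))) : Prop :=
  ∀ U : Set (EuclideanSpace ℝ (Fin N)), MeasurableSet U → ν (-U) = ν U

/-- The area `σ_N` of the unit sphere of the Euclidean space `ℝ^N`: the total mass of the
surface measure that Lebesgue measure induces on the sphere. -/
noncomputable def sphereArea (N : ℕ) : ℝ :=
  (volume : Measure (EuclideanSpace ℝ (Fin N))).toSphere.real Set.univ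

/-- The ellipsoid `t g B`, where `B` is the open unit ball of `ℝ^N` centered at `0`. -/
def ellipsoid {N : ℕ} (g : Matrix.SpecialLinearGroup (Fin N) ℝ) (t : ℝ) :
    Set (EuclideanSpace ℝ (Fin N)) :=
  t • (Matrix.toEuclideanLin (g : Matrix (Fin N) (Fin N) ℝ) ''
    Metric.ball (0 : EuclideanSpace ℝ (Fin N)) 1)

/-! ### Ellipsoids: membership, volume, interpolation by a dense family. -/

section Ellipsoids

variable {N : ℕ}

/-! It suffices to pass to the limit along each ultrafilter finer than the given filter. Ellipsoids
from `F` cover any compact set with eventually bounded mass, so integrals of test functions converge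
along the ultrafilter, and Riesz-Markov-Kakutani makes the limit a regular measure μ
(`exists_regular_tendsto_integral`), again even. Bump functions squeezed between ellipsoids, with
density of `F`, give μ(tgB) = c m(tgB) for all g and t (`measure_ellipsoid_eq_of_tendsto`).

It remains to see that these values force μ = c m (`IsEvenMeasure.eq_of_ellipsoid_eq`). Sublevel
sets of a positive definite form q are ellipsoids, so the image of μ under q is known, hence so is ∫
exp(-q) dμ. Taking q(x) = ‖x‖² - s⟨V(x), T⟩, with V the Veronese map and s small, gives the
exponential moments near 0 of every linear functional of V under exp(-‖x‖²)μ. Analytic continuation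
to the imaginary axis yields the characteristic function of the image under V. Since V identifies
only x with -x, evenness recovers exp(-‖x‖²)μ, and then μ. -/

theorem mem_ellipsoid {g : Matrix.SpecialLinearGroup (Fin N) ℝ} {t : ℝ} (ht : 0 < t)
    {x : EuclideanSpace ℝ (Fin N)} :
    x ∈ ellipsoid g t ↔
      ‖Matrix.toEuclideanCLM (𝕜 := ℝ) (↑(g⁻¹) : Matrix (Fin N) (Fin N) ℝ) x‖ < t := by
  have h1 : (g : Matrix (Fin N) (Fin N) ℝ) * (↑(g⁻¹) : Matrix (Fin N) (Fin N) ℝ) = 1 := by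
    rw [← Matrix.SpecialLinearGroup.coe_mul, mul_inv_cancel, Matrix.SpecialLinearGroup.coe_one]
  have h2 : (↑(g⁻¹) : Matrix (Fin N) (Fin N) ℝ) * (g : Matrix (Fin N) (Fin N) ℝ) = 1 := by
    rw [← Matrix.SpecialLinearGroup.coe_mul, inv_mul_cancel, Matrix.SpecialLinearGroup.coe_one]
  have e1 (y) : Matrix.toEuclideanCLM (𝕜 := ℝ) (g : Matrix (Fin N) (Fin N) ℝ)
      (Matrix.toEuclideanCLM (𝕜 := ℝ) (↑(g⁻¹) : Matrix (Fin N) (Fin N) ℝ) y) = y := by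
    rw [← mul_apply_eq_comp, ← map_mul, h1, map_one, one_apply_eq_self]
  have e2 (y) : Matrix.toEuclideanCLM (𝕜 := ℝ) (↑(g⁻¹) : Matrix (Fin N) (Fin N) ℝ)
      (Matrix.toEuclideanCLM (𝕜 := ℝ) (g : Matrix (Fin N) (Fin N) ℝ) y) = y := by
    rw [← mul_apply_eq_comp, ← map_mul, h2, map_one, one_apply_eq_self]
  have hlin (y) : Matrix.toEuclideanLin (g : Matrix (Fin N) (Fin N) ℝ) y =
      Matrix.toEuclideanCLM (𝕜 := ℝ) (g : Matrix (Fin N) (Fin N) ℝ) y := rfl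
  rw [ellipsoid, Set.mem_smul_set]
  constructor
  · rintro ⟨_, ⟨y, hy, rfl⟩, rfl⟩
    rw [hlin, map_smul, e2, norm_smul, Real.norm_of_nonneg ht.le]
    have := mem_ball_zero_iff.1 hy
    nlinarith
  · intro h
    refine ⟨_, ⟨t⁻¹ • Matrix.toEuclideanCLM (𝕜 := ℝ) (↑(g⁻¹) : Matrix (Fin N) (Fin N) ℝ) x,
      ?_, rfl⟩, ?_⟩
    · rw [mem_ball_zero_iff, norm_smul, norm_inv, Real.norm_of_nonneg ht.le, inv_mul_lt_iff₀ ht]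
      simpa using h
    · rw [hlin, map_smul, e1, smul_inv_smul₀ ht.ne']

theorem isOpen_ellipsoid (g : Matrix.SpecialLinearGroup (Fin N) ℝ) {t : ℝ} (ht : 0 < t) :
    IsOpen (ellipsoid g t) := by
  have : ellipsoid g t = {x | ‖Matrix.toEuclideanCLM (𝕜 := ℝ)
      (↑(g⁻¹) : Matrix (Fin N) (Fin N) ℝ) x‖ < t} := Set.ext fun x => mem_ellipsoid ht
  rw [this]
  exact isOpen_lt (by fun_prop) continuous_const

theorem isBounded_ellipsoid (g : Matrix.SpecialLinearGroup (Fin N) ℝ) (t : ℝ) :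
    Bornology.IsBounded (ellipsoid g t) :=
  ((Metric.isBounded_ball (x := (0 : EuclideanSpace ℝ (Fin N))) (r := 1)).image
    (Matrix.toEuclideanCLM (𝕜 := ℝ) (g : Matrix (Fin N) (Fin N) ℝ))).smul₀ t

theorem mem_ellipsoid_one {t : ℝ} (ht : 0 < t) {x : EuclideanSpace ℝ (Fin N)} :
    x ∈ ellipsoid 1 t ↔ ‖x‖ < t := by
  rw [mem_ellipsoid ht, inv_one, Matrix.SpecialLinearGroup.coe_one, map_one,
    one_apply_eq_self]

theorem closure_ellipsoid_subset (g : Matrix.SpecialLinearGroup (Fin N) ℝ) {s t : ℝ}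
    (hs : 0 < s) (hst : s < t) : closure (ellipsoid g s) ⊆ ellipsoid g t := by
  have hcl : IsClosed {x | ‖Matrix.toEuclideanCLM (𝕜 := ℝ)
      (↑(g⁻¹) : Matrix (Fin N) (Fin N) ℝ) x‖ ≤ s} := isClosed_le (by fun_prop) continuous_const
  intro x hx
  have := closure_minimal (fun y hy => ((mem_ellipsoid hs).1 hy).le) hcl hx
  exact (mem_ellipsoid (hs.trans hst)).2 (lt_of_le_of_lt this hst)

theorem volume_ellipsoid (hN : 1 ≤ N) (g : Matrix.SpecialLinearGroup (Fin N) ℝ) {t : ℝ}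
    (ht : 0 < t) :
    (volume : Measure (EuclideanSpace ℝ (Fin N))) (ellipsoid g t) =
      ENNReal.ofReal (t ^ N * (sphereArea N / N)) := by
  have hN' : (N : ℝ) ≠ 0 := by positivity
  have hdet : LinearMap.det (Matrix.toEuclideanLin (g : Matrix (Fin N) (Fin N) ℝ)) = 1 := by
    rw [Matrix.toEuclideanLin_eq_toLin_orthonormal, LinearMap.det_toLin]
    exact g.2
  have hball : sphereArea N / N =
      (volume : Measure (EuclideanSpace ℝ (Fin N))).real (Metric.ball 0 1) := by
    rw [sphereArea, Measure.toSphere_real_apply_univ, finrank_euclideanSpace_fin]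
    field_simp
  rw [ellipsoid, Measure.addHaar_smul, Measure.addHaar_image_linearMap, hdet, hball,
    finrank_euclideanSpace_fin, abs_one, ENNReal.ofReal_one, one_mul, abs_of_pos (by positivity),
    ENNReal.ofReal_mul (by positivity), ofReal_measureReal]

theorem sphereArea_div_pos (hN : 1 ≤ N) : 0 < sphereArea N / N := by
  have : 0 < (volume : Measure (EuclideanSpace ℝ (Fin N))) (ellipsoid 1 1) :=
    (isOpen_ellipsoid 1 one_pos).measure_pos _
      ⟨0, (mem_ellipsoid_one one_pos).2 (by simp)⟩
  rw [volume_ellipsoid hN 1 one_pos] at this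
  simpa using this

/-- Ellipsoids from a dense family interpolate between any two homothetic ellipsoids. -/
theorem exists_ellipsoid_between
    {F : Set (Matrix.SpecialLinearGroup (Fin N) ℝ × Set.Ioi (0 : ℝ))} (hF : Dense F)
    (g : Matrix.SpecialLinearGroup (Fin N) ℝ) {a b : ℝ} (ha : 0 < a) (hab : a < b) :
    ∃ p ∈ F, a < (p.2 : ℝ) ∧ (p.2 : ℝ) < b ∧
      ellipsoid g a ⊆ ellipsoid p.1 p.2 ∧ ellipsoid p.1 p.2 ⊆ ellipsoid g b := by
  let T : Matrix.SpecialLinearGroup (Fin N) ℝ →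
      EuclideanSpace ℝ (Fin N) →L[ℝ] EuclideanSpace ℝ (Fin N) :=
    fun h => Matrix.toEuclideanCLM (𝕜 := ℝ) (h : Matrix (Fin N) (Fin N) ℝ)
  have hTc : Continuous T := by
    let L : Matrix (Fin N) (Fin N) ℝ →ₗ[ℝ]
        EuclideanSpace ℝ (Fin N) →L[ℝ] EuclideanSpace ℝ (Fin N) :=
      { toFun := Matrix.toEuclideanCLM (𝕜 := ℝ)
        map_add' := map_add _
        map_smul' := map_smul _ }
    have hval : Continuous fun h : Matrix.SpecialLinearGroup (Fin N) ℝ =>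
        (h : Matrix (Fin N) (Fin N) ℝ) := continuous_subtype_val
    exact L.continuous_of_finiteDimensional.comp hval
  have hTmul (h k) : T (h * k) = T h * T k := by
    simp only [T, Matrix.SpecialLinearGroup.coe_mul, map_mul]
  have hT1 : T 1 = 1 := by simp only [T, Matrix.SpecialLinearGroup.coe_one, map_one]
  -- The operator norm bounds force the two inclusions. They are open conditions, and hold at (g, (a
  -- + b)/2), where both operators are the identity.
  let S : Set (Matrix.SpecialLinearGroup (Fin N) ℝ × Set.Ioi (0 : ℝ)) :=
    {p | ‖T (p.1⁻¹ * g)‖ * a < (p.2 : ℝ) ∧ ‖T (g⁻¹ * p.1)‖ * (p.2 : ℝ) < b ∧ a < (p.2 : ℝ) ∧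
      (p.2 : ℝ) < b}
  have hS : IsOpen S := by
    refine IsOpen.inter (isOpen_lt (α := ℝ) ?_ ?_) (IsOpen.inter (isOpen_lt (α := ℝ) ?_ ?_)
      (IsOpen.inter (isOpen_lt (α := ℝ) ?_ ?_) (isOpen_lt (α := ℝ) ?_ ?_))) <;> fun_prop
  have hone : ‖(1 : EuclideanSpace ℝ (Fin N) →L[ℝ] EuclideanSpace ℝ (Fin N))‖ ≤ 1 :=
    ContinuousLinearMap.norm_id_le
  have hne : S.Nonempty := by
    refine ⟨(g, ⟨(a + b) / 2, by simp only [Set.mem_Ioi]; linarith⟩), ?_⟩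
    simp only [S, Set.mem_ofPred_eq, inv_mul_cancel, hT1]
    refine ⟨?_, ?_, ?_, ?_⟩ <;> nlinarith
  obtain ⟨p, hpF, h1, h2, h3, h4⟩ := hF.exists_mem_open hS hne
  have hp : (0 : ℝ) < p.2 := p.2.2
  have key (h k : Matrix.SpecialLinearGroup (Fin N) ℝ) (x) :
      ‖T h⁻¹ x‖ ≤ ‖T (h⁻¹ * k)‖ * ‖T k⁻¹ x‖ := by
    have : T h⁻¹ x = T (h⁻¹ * k) (T k⁻¹ x) := by
      rw [← mul_apply_eq_comp, ← hTmul, mul_assoc, mul_inv_cancel, mul_one]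
    rw [this]
    exact ContinuousLinearMap.le_opNorm _ _
  refine ⟨p, hpF, h3, h4, fun x hx => ?_, fun x hx => ?_⟩
  · rw [mem_ellipsoid ha] at hx
    rw [mem_ellipsoid hp]
    exact (key p.1 g x).trans_lt ((mul_le_mul_of_nonneg_left hx.le (norm_nonneg _)).trans_lt h1)
  · rw [mem_ellipsoid hp] at hx
    rw [mem_ellipsoid (ha.trans hab)]
    exact (key g p.1 x).trans_lt ((mul_le_mul_of_nonneg_left hx.le (norm_nonneg _)).trans_lt h2)

end Ellipsoids

/-! ### Positive definite forms and the Veronese map. -/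

section QuadraticForms

variable {N : ℕ}

open scoped MatrixOrder in
/-- Every sublevel set of a positive definite quadratic form is one of the ellipsoids. -/
theorem exists_ellipsoid_eq_sublevel (hN : 1 ≤ N) {Q : Matrix (Fin N) (Fin N) ℝ}
    (hQ : Q.PosDef) {r : ℝ} (hr : 0 < r) :
    ∃ (g : Matrix.SpecialLinearGroup (Fin N) ℝ) (t : ℝ), 0 < t ∧
      ellipsoid g t = {x | inner ℝ x (Matrix.toEuclideanCLM (𝕜 := ℝ) Q x) < r} := by
  obtain ⟨A, hAstar, hAA, hdet⟩ : ∃ A : Matrix (Fin N) (Fin N) ℝ,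
      star A = A ∧ A * A = Q ∧ 0 < A.det := by
    have h0 : 0 ≤ Q := Matrix.nonneg_iff_posSemidef.2 hQ.posSemidef
    have hA : (CFC.sqrt Q).PosSemidef := Matrix.nonneg_iff_posSemidef.1 (CFC.sqrt_nonneg Q)
    have hmul : CFC.sqrt Q * CFC.sqrt Q = Q := CFC.sqrt_mul_sqrt_self Q
    refine ⟨CFC.sqrt Q, hA.isHermitian, hmul, lt_of_le_of_ne hA.det_nonneg fun h => ?_⟩
    have := hQ.det_pos
    rw [← hmul, Matrix.det_mul, ← h] at this
    simp at this
  have hN0 : N ≠ 0 := by omega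
  -- With A = √Q the form is ‖Ax‖². Dividing A by the N-th root of its determinant lands in SL(N),
  -- and the factor s moves into the radius √r / s.
  obtain ⟨s, hs, hsN⟩ : ∃ s : ℝ, 0 < s ∧ s ^ N = A.det :=
    ⟨A.det ^ ((N : ℝ)⁻¹), Real.rpow_pos_of_pos hdet _, Real.rpow_inv_natCast_pow hdet.le hN0⟩
  have hdet1 : (s⁻¹ • A).det = 1 := by
    rw [Matrix.det_smul, Fintype.card_fin, inv_pow, hsN, inv_mul_cancel₀ hdet.ne']
  obtain ⟨h, hh⟩ : ∃ h : Matrix.SpecialLinearGroup (Fin N) ℝ,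
      (h : Matrix (Fin N) (Fin N) ℝ) = s⁻¹ • A := ⟨⟨_, hdet1⟩, rfl⟩
  have ht : 0 < √r / s := by positivity
  refine ⟨h⁻¹, √r / s, ht, ?_⟩
  ext x
  have hinner : inner ℝ x (Matrix.toEuclideanCLM (𝕜 := ℝ) Q x) =
      ‖Matrix.toEuclideanCLM (𝕜 := ℝ) A x‖ ^ 2 := by
    rw [← hAA, map_mul, mul_apply_eq_comp, ← ContinuousLinearMap.adjoint_inner_left,
      ← ContinuousLinearMap.star_eq_adjoint, ← map_star, hAstar, real_inner_self_eq_norm_sq]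
  rw [mem_ellipsoid ht, inv_inv, Set.mem_ofPred_eq, hinner, ← Real.lt_sqrt (norm_nonneg _), hh, map_smul, smul_apply, norm_smul, Real.norm_of_nonneg (inv_pos.2 hs).le,
    inv_mul_eq_div, div_lt_div_iff_of_pos_right hs]

/-- The quadratic Veronese map, sending a vector to the matrix of products of its coordinates. -/
noncomputable def veronese (x : EuclideanSpace ℝ (Fin N)) : EuclideanSpace ℝ (Fin N × Fin N) :=
  WithLp.toLp 2 fun p => x p.1 * x p.2

@[fun_prop]
theorem continuous_veronese : Continuous (veronese : EuclideanSpace ℝ (Fin N) → _) := by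
  unfold veronese
  fun_prop

theorem norm_veronese (x : EuclideanSpace ℝ (Fin N)) : ‖veronese x‖ = ‖x‖ ^ 2 := by
  rw [← sq_eq_sq₀ (norm_nonneg _) (by positivity), EuclideanSpace.real_norm_sq_eq,
    EuclideanSpace.real_norm_sq_eq, Fintype.sum_prod_type, sq (∑ i, x i ^ 2), Finset.sum_mul_sum]
  simp only [veronese, mul_pow]

theorem veronese_eq_iff {x y : EuclideanSpace ℝ (Fin N)} :
    veronese x = veronese y ↔ x = y ∨ x = -y := by
  constructor
  · intro h
    have h' (i j) : x i * x j = y i * y j := congrFun (congrArg WithLp.ofLp h) (i, j)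
    by_cases hx : x = 0
    · left
      subst hx
      ext i
      have := h' i i
      simp only [PiLp.zero_apply, mul_zero] at this ⊢
      exact (mul_self_eq_zero.1 this.symm).symm
    · obtain ⟨i, hi⟩ : ∃ i, x i ≠ 0 := by
        by_contra! hcon
        exact hx (by ext i; simpa using hcon i)
      rcases mul_self_eq_mul_self_iff.1 (h' i i) with hii | hii
      · left
        ext j
        have := h' i j
        rw [← hii] at this
        exact mul_left_cancel₀ hi this
      · right
        ext j
        have := h' i j
        rw [show y i = -x i by linarith] at this
        rw [PiLp.neg_apply]
        exact mul_left_cancel₀ hi (by linarith)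
  · rintro (rfl | rfl)
    · rfl
    · ext p
      simp [veronese]

theorem abs_inner_veronese_le (x : EuclideanSpace ℝ (Fin N))
    (T : EuclideanSpace ℝ (Fin N × Fin N)) :
    |inner ℝ (veronese x) T| ≤ ‖T‖ * ‖x‖ ^ 2 := by
  rw [← norm_veronese, mul_comm]
  exact abs_real_inner_le_norm _ _

/-- Small perturbations of the squared norm by quadratic forms are given by positive definite
matrices. -/
theorem exists_posDef_inner_eq (T : EuclideanSpace ℝ (Fin N × Fin N)) {s : ℝ}
    (hs : |s| * ‖T‖ < 1) :
    ∃ Q : Matrix (Fin N) (Fin N) ℝ, Q.PosDef ∧ ∀ x : EuclideanSpace ℝ (Fin N),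
      inner ℝ x (Matrix.toEuclideanCLM (𝕜 := ℝ) Q x) =
        ‖x‖ ^ 2 - s * inner ℝ (veronese x) T := by
  let M : Matrix (Fin N) (Fin N) ℝ := Matrix.of fun i j => T (i, j)
  have hM (x : EuclideanSpace ℝ (Fin N)) :
      inner ℝ x (Matrix.toEuclideanCLM (𝕜 := ℝ) M x) = inner ℝ (veronese x) T := by
    simp only [PiLp.inner_apply, Fintype.sum_prod_type, Matrix.ofLp_toEuclideanCLM, Matrix.mulVec,
      dotProduct, veronese, M, Matrix.of_apply, RCLike.inner_apply, conj_trivial,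
      Finset.sum_mul]
    exact Finset.sum_congr rfl fun i _ => Finset.sum_congr rfl fun j _ => by ring
  have hMt (x : EuclideanSpace ℝ (Fin N)) :
      inner ℝ x (Matrix.toEuclideanCLM (𝕜 := ℝ) M.transpose x) = inner ℝ (veronese x) T := by
    rw [← hM, ← Matrix.conjTranspose_eq_transpose_of_trivial, ← Matrix.star_eq_conjTranspose,
      map_star, ContinuousLinearMap.star_eq_adjoint, ContinuousLinearMap.adjoint_inner_right,
      real_inner_comm]
  -- Symmetrizing M keeps its quadratic form and makes Q Hermitian, as positive definiteness
  -- requires.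
  let Q : Matrix (Fin N) (Fin N) ℝ := 1 - (s / 2) • (M + M.transpose)
  have hQ (x : EuclideanSpace ℝ (Fin N)) :
      inner ℝ x (Matrix.toEuclideanCLM (𝕜 := ℝ) Q x) =
        ‖x‖ ^ 2 - s * inner ℝ (veronese x) T := by
    simp only [Q, map_sub, map_one, map_smul, map_add, sub_apply,
      smul_apply, add_apply, one_apply_eq_self,
      inner_sub_right, inner_smul_right, inner_add_right, hM, hMt, real_inner_self_eq_norm_sq]
    ring
  refine ⟨Q, Matrix.PosDef.of_dotProduct_mulVec_pos ?_ fun x hx => ?_, hQ⟩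
  · rw [Matrix.IsHermitian, Matrix.conjTranspose_eq_transpose_of_trivial]
    simp [Q, add_comm]
  · have h1 := hQ (WithLp.toLp 2 x)
    have h2 := abs_inner_veronese_le (WithLp.toLp 2 x) T
    have hpos : 0 < ‖WithLp.toLp 2 x‖ ^ 2 := by
      have : WithLp.toLp 2 x ≠ 0 := by simpa using hx
      positivity
    have h3 : s * inner ℝ (veronese (WithLp.toLp 2 x)) T < ‖WithLp.toLp 2 x‖ ^ 2 := by
      calc _ ≤ |s * inner ℝ (veronese (WithLp.toLp 2 x)) T| := le_abs_self _
        _ = |s| * |inner ℝ (veronese (WithLp.toLp 2 x)) T| := abs_mul _ _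
        _ ≤ |s| * (‖T‖ * ‖WithLp.toLp 2 x‖ ^ 2) := by gcongr
        _ = (|s| * ‖T‖) * ‖WithLp.toLp 2 x‖ ^ 2 := by ring
        _ < _ := by nlinarith
    rw [Matrix.inner_toEuclideanCLM] at h1
    have : star x ⬝ᵥ Q.mulVec x = _ := h1
    rw [this]
    linarith

end QuadraticForms

/-! ### Even measures are determined by ellipsoids. -/

section Uniqueness

open ProbabilityTheory

/-- Two measures that agree on the sublevel sets of `q`, with finite values, have the same image
under `q`. -/
theorem map_eq_of_measure_sublevel_eq {X : Type*} [MeasurableSpace X] {μ ν : Measure X}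
    {q : X → ℝ} (hq : Measurable q) (hfin : ∀ r, ν {x | q x < r} ≠ ⊤)
    (h : ∀ r, μ {x | q x < r} = ν {x | q x < r}) : μ.map q = ν.map q := by
  have hval (m : Measure X) (r : ℝ) : m.map q (Set.Iio r) = m {x | q x < r} :=
    Measure.map_apply hq measurableSet_Iio
  refine Measure.ext_of_generateFrom_of_iUnion (Set.range Set.Iio) (fun n : ℕ => Set.Iio (n : ℝ))
    ((BorelSpace.measurable_eq (α := ℝ)).trans (borel_eq_generateFrom_Iio ℝ)) ?_ ?_
    (fun n => ⟨n, rfl⟩) ?_ ?_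
  · rw [← Set.image_univ]
    exact isPiSystem_image_Iio _
  · exact Set.eq_univ_of_forall fun x => Set.mem_iUnion.2 (exists_nat_gt x)
  · intro n
    rw [hval, h]
    exact hfin n
  · rintro _ ⟨r, rfl⟩
    rw [hval, hval, h]

/-- Finite measures for which a random variable has the same finite exponential moments near `0`
give it the same characteristic function. -/
theorem complexMGF_mul_I_eq_of_lintegral_exp_eq {X : Type*} [MeasurableSpace X] {μ ν : Measure X}
    {f : X → ℝ} (hf : Measurable f) {ε : ℝ} (hε : 0 < ε)
    (hfin : ∀ s : ℝ, |s| < ε → ∫⁻ x, ENNReal.ofReal (Real.exp (s * f x)) ∂ν ≠ ⊤)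
    (h : ∀ s : ℝ, |s| < ε → ∫⁻ x, ENNReal.ofReal (Real.exp (s * f x)) ∂μ =
      ∫⁻ x, ENNReal.ofReal (Real.exp (s * f x)) ∂ν) (t : ℝ) :
    complexMGF f μ (t * Complex.I) = complexMGF f ν (t * Complex.I) := by
  have hmeas (s : ℝ) : Measurable fun x => Real.exp (s * f x) := by fun_prop
  have hint (m : Measure X) (hm : ∀ s : ℝ, |s| < ε →
      ∫⁻ x, ENNReal.ofReal (Real.exp (s * f x)) ∂m ≠ ⊤) :
      Set.Ioo (-ε) ε ⊆ interior (integrableExpSet f m) := by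
    refine interior_maximal (fun s hs => ?_) isOpen_Ioo
    exact (lintegral_ofReal_ne_top_iff_integrable (hmeas s).aestronglyMeasurable
      (Eventually.of_forall fun x => (Real.exp_pos _).le)).1 (hm s (abs_lt.2 hs))
  have hμ := hint μ fun s hs => (h s hs).symm ▸ hfin s hs
  have hν := hint ν hfin
  -- Both complex moment generating functions are analytic on this vertical strip, which contains
  -- the imaginary axis; they agree at real points accumulating at 0.
  let U : Set ℂ := {z | z.re ∈ Set.Ioo (-ε) ε}
  have hU : IsPreconnected U := by
    have : Convex ℝ U := (convex_Ioo (-ε) ε).linear_preimage Complex.reLm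
    exact this.isPreconnected
  have h0 : (0 : ℂ) ∈ U := by simp [U, hε]
  refine AnalyticOnNhd.eqOn_of_preconnected_of_frequently_eq
    (analyticOnNhd_complexMGF.mono fun z hz => hμ hz)
    (analyticOnNhd_complexMGF.mono fun z hz => hν hz) hU h0 ?_ ?_
  · have hreal : ∀ s : ℝ, |s| < ε → complexMGF f μ s = complexMGF f ν s := by
      intro s hs
      rw [complexMGF_ofReal, complexMGF_ofReal, mgf, mgf,
        integral_eq_lintegral_of_nonneg_ae (Eventually.of_forall fun x => (Real.exp_pos _).le)
          (hmeas s).aestronglyMeasurable,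
        integral_eq_lintegral_of_nonneg_ae (Eventually.of_forall fun x => (Real.exp_pos _).le)
          (hmeas s).aestronglyMeasurable, h s hs]
    have hev : ∀ᶠ s : ℝ in 𝓝[≠] 0, complexMGF f μ s = complexMGF f ν s := by
      have : ∀ᶠ s : ℝ in 𝓝 0, |s| < ε := by
        have := Metric.ball_mem_nhds (0 : ℝ) hε
        filter_upwards [this] with s hs
        simpa using hs
      exact (this.filter_mono nhdsWithin_le_nhds).mono hreal
    have htend : Tendsto (fun s : ℝ => (s : ℂ)) (𝓝[≠] 0) (𝓝[≠] 0) := by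
      refine tendsto_nhdsWithin_iff.2 ⟨?_, ?_⟩
      · have : Tendsto (fun s : ℝ => (s : ℂ)) (𝓝 0) (𝓝 ((0 : ℝ) : ℂ)) :=
          Complex.continuous_ofReal.tendsto 0
        exact (this.mono_left nhdsWithin_le_nhds).trans (by simp)
      · filter_upwards [self_mem_nhdsWithin] with s hs
        simpa using hs
    exact htend.frequently hev.frequently
  · change (t * Complex.I).re ∈ Set.Ioo (-ε) ε
    simp [hε]

variable {N : ℕ}

/-- The Gaussian weight `exp (-‖x‖ ^ 2)`, with values in the extended nonnegative reals. -/
noncomputable def gaussianWeight (x : EuclideanSpace ℝ (Fin N)) : ENNReal :=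
  ENNReal.ofReal (Real.exp (-‖x‖ ^ 2))

theorem measurable_gaussianWeight :
    Measurable (gaussianWeight : EuclideanSpace ℝ (Fin N) → ENNReal) := by
  unfold gaussianWeight
  fun_prop

theorem lintegral_exp_veronese_withDensity (μ : Measure (EuclideanSpace ℝ (Fin N)))
    (T : EuclideanSpace ℝ (Fin N × Fin N)) (s : ℝ) :
    ∫⁻ x, ENNReal.ofReal (Real.exp (s * inner ℝ (veronese x) T)) ∂(μ.withDensity gaussianWeight) =
      ∫⁻ x, ENNReal.ofReal (Real.exp (-(‖x‖ ^ 2 - s * inner ℝ (veronese x) T))) ∂μ := by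
  rw [lintegral_withDensity_eq_lintegral_mul _ measurable_gaussianWeight (by fun_prop)]
  refine lintegral_congr fun x => ?_
  rw [Pi.mul_apply, gaussianWeight, ← ENNReal.ofReal_mul (Real.exp_pos _).le, ← Real.exp_add]
  ring_nf

variable {μ ν : Measure (EuclideanSpace ℝ (Fin N))}

/-- Measures that agree on ellipsoids have the same integrals of Gaussians. -/
theorem lintegral_exp_quadratic_eq (hN : 1 ≤ N) [IsLocallyFiniteMeasure ν]
    (h : ∀ (g : Matrix.SpecialLinearGroup (Fin N) ℝ) (t : ℝ), 0 < t →
      μ (ellipsoid g t) = ν (ellipsoid g t))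
    {Q : Matrix (Fin N) (Fin N) ℝ} (hQ : Q.PosDef) :
    ∫⁻ x, ENNReal.ofReal (Real.exp (-inner ℝ x (Matrix.toEuclideanCLM (𝕜 := ℝ) Q x))) ∂μ =
      ∫⁻ x, ENNReal.ofReal (Real.exp (-inner ℝ x (Matrix.toEuclideanCLM (𝕜 := ℝ) Q x))) ∂ν := by
  let q : EuclideanSpace ℝ (Fin N) → ℝ :=
    fun x => inner ℝ x (Matrix.toEuclideanCLM (𝕜 := ℝ) Q x)
  have hq : Measurable q := by
    have : Continuous q := by fun_prop
    exact this.measurable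
  have hq0 (x) : 0 ≤ q x := by
    have := hQ.posSemidef.dotProduct_mulVec_nonneg (WithLp.ofLp x)
    simp only [q, Matrix.inner_toEuclideanCLM]
    simpa using this
  have hsub (r : ℝ) : μ {x | q x < r} = ν {x | q x < r} ∧ ν {x | q x < r} ≠ ⊤ := by
    rcases le_or_gt r 0 with hr | hr
    · have : {x | q x < r} = ∅ := Set.eq_empty_of_forall_notMem fun x hx =>
        absurd (hq0 x) (not_le.2 (lt_of_lt_of_le hx hr))
      simp [this]
    · obtain ⟨g, t, ht, hgt⟩ := exists_ellipsoid_eq_sublevel hN hQ hr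
      change μ {x | inner ℝ x (Matrix.toEuclideanCLM (𝕜 := ℝ) Q x) < r} =
        ν {x | inner ℝ x (Matrix.toEuclideanCLM (𝕜 := ℝ) Q x) < r} ∧
        ν {x | inner ℝ x (Matrix.toEuclideanCLM (𝕜 := ℝ) Q x) < r} ≠ ⊤
      rw [← hgt]
      exact ⟨h g t ht, (isBounded_ellipsoid g t).measure_lt_top.ne⟩
  have hmap := map_eq_of_measure_sublevel_eq hq (fun r => (hsub r).2) (fun r => (hsub r).1)
  have hexp : Measurable fun y : ℝ => ENNReal.ofReal (Real.exp (-y)) := by fun_prop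
  change ∫⁻ x, ENNReal.ofReal (Real.exp (-q x)) ∂μ = ∫⁻ x, ENNReal.ofReal (Real.exp (-q x)) ∂ν
  rw [← lintegral_map hexp hq, ← lintegral_map hexp hq, hmap]

/-- The characteristic function at T is the complex moment generating function of ⟨V(x), T⟩ at i, so
agreement of real exponential moments near 0 is enough. -/
theorem map_veronese_withDensity_eq (hN : 1 ≤ N) [IsLocallyFiniteMeasure ν]
    (hgauss : ∀ b : ℝ, 0 < b → ∫⁻ x, ENNReal.ofReal (Real.exp (-b * ‖x‖ ^ 2)) ∂ν ≠ ⊤)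
    (h : ∀ (g : Matrix.SpecialLinearGroup (Fin N) ℝ) (t : ℝ), 0 < t →
      μ (ellipsoid g t) = ν (ellipsoid g t))
    [IsFiniteMeasure (μ.withDensity gaussianWeight)]
    [IsFiniteMeasure (ν.withDensity gaussianWeight)] :
    (μ.withDensity gaussianWeight).map veronese = (ν.withDensity gaussianWeight).map veronese := by
  refine Measure.ext_of_charFun (funext fun T => ?_)
  have hf : Measurable fun x : EuclideanSpace ℝ (Fin N) => inner ℝ (veronese x) T := by fun_prop
  have hchar (m : Measure (EuclideanSpace ℝ (Fin N))) :
      charFun (m.map veronese) T =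
        complexMGF (fun x => inner ℝ (veronese x) T) m ((1 : ℝ) * Complex.I) := by
    rw [charFun_apply, integral_map (by fun_prop) (by fun_prop), complexMGF]
    simp only [Complex.ofReal_one, mul_one, mul_comm]
  rw [hchar, hchar]
  have hlt {s : ℝ} (hs : |s| < (‖T‖ + 1)⁻¹) : |s| * ‖T‖ < 1 := by
    have h1 : |s| * (‖T‖ + 1) < 1 :=
      calc |s| * (‖T‖ + 1) < (‖T‖ + 1)⁻¹ * (‖T‖ + 1) := by gcongr
        _ = 1 := inv_mul_cancel₀ (by positivity)
    nlinarith [abs_nonneg s]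
  refine complexMGF_mul_I_eq_of_lintegral_exp_eq hf (ε := (‖T‖ + 1)⁻¹) (by positivity) ?_ ?_ 1
  · intro s hs
    rw [lintegral_exp_veronese_withDensity]
    -- The perturbed form is at least (1 - |s|‖T‖)‖x‖², still a Gaussian of positive rate.
    refine ne_top_of_le_ne_top (hgauss (1 - |s| * ‖T‖) (by linarith [hlt hs])) ?_
    refine lintegral_mono fun x => ENNReal.ofReal_le_ofReal (Real.exp_le_exp.2 ?_)
    have : s * inner ℝ (veronese x) T ≤ |s| * (‖T‖ * ‖x‖ ^ 2) :=
      calc _ ≤ |s * inner ℝ (veronese x) T| := le_abs_self _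
        _ = |s| * |inner ℝ (veronese x) T| := abs_mul _ _
        _ ≤ _ := by gcongr; exact abs_inner_veronese_le x T
    linarith
  · intro s hs
    obtain ⟨Q, hQ, hQx⟩ := exists_posDef_inner_eq T (hlt hs)
    rw [lintegral_exp_veronese_withDensity, lintegral_exp_veronese_withDensity]
    simp only [← hQx]
    exact lintegral_exp_quadratic_eq hN h hQ

theorem IsEvenMeasure.map_neg (hμ : IsEvenMeasure μ) :
    μ.map Neg.neg = μ := by
  ext V hV
  rw [Measure.map_apply measurable_neg hV]
  exact hμ V hV

theorem IsEvenMeasure.withDensity_gaussianWeight (hμ : IsEvenMeasure μ) :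
    IsEvenMeasure (μ.withDensity gaussianWeight) := by
  intro U hU
  rw [withDensity_apply _ hU.neg, withDensity_apply _ hU]
  nth_rw 2 [← hμ.map_neg]
  rw [setLIntegral_map hU measurable_gaussianWeight measurable_neg]
  simp [gaussianWeight, Set.neg_preimage]

/-- Expresses `P K` through symmetric sets, the only ones the Veronese map can see. -/
theorem IsEvenMeasure.two_mul_measure {P : Measure (EuclideanSpace ℝ (Fin N))}
    (hP : IsEvenMeasure P) {K : Set (EuclideanSpace ℝ (Fin N))} (hK : MeasurableSet K) :
    2 * P K = P (K ∪ -K) + P (K ∩ -K) := by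
  rw [measure_union_add_inter _ hK.neg, hP K hK, two_mul]

/-- An even finite measure is determined by its image under the Veronese map. -/
theorem IsEvenMeasure.eq_of_map_veronese_eq {P P' : Measure (EuclideanSpace ℝ (Fin N))}
    [IsFiniteMeasure P] [IsFiniteMeasure P'] (hP : IsEvenMeasure P) (hP' : IsEvenMeasure P')
    (h : P.map veronese = P'.map veronese) : P = P' := by
  have hsymm {K : Set (EuclideanSpace ℝ (Fin N))} (hK : IsCompact K) (hKneg : -K = K) :
      P K = P' K := by
    have hpre : veronese ⁻¹' (veronese '' K) = K := by
      refine Set.Subset.antisymm ?_ (Set.subset_preimage_image _ _)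
      rintro x ⟨y, hy, hyx⟩
      rcases veronese_eq_iff.1 hyx with rfl | rfl
      · exact hy
      · rwa [← hKneg, Set.mem_neg]
    -- Compactness of K makes its image measurable; general Borel sets are reached by inner
    -- regularity at the end.
    have hmeas : MeasurableSet (veronese '' K) :=
      (hK.image continuous_veronese).measurableSet
    rw [← hpre, ← Measure.map_apply continuous_veronese.measurable hmeas, h,
      Measure.map_apply continuous_veronese.measurable hmeas]
  have hcomp {K : Set (EuclideanSpace ℝ (Fin N))} (hK : IsCompact K) : P K = P' K := by
    have h1 := hsymm (hK.union hK.neg) (by rw [Set.union_neg, neg_neg, Set.union_comm])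
    have h2 := hsymm (hK.inter hK.neg) (by rw [Set.inter_neg, neg_neg, Set.inter_comm])
    have h3 : 2 * P K = 2 * P' K := by
      rw [hP.two_mul_measure hK.measurableSet, hP'.two_mul_measure hK.measurableSet, h1, h2]
    exact (ENNReal.mul_right_inj (by simp) (by simp)).1 h3
  ext U hU
  rw [hU.measure_eq_iSup_isCompact, hU.measure_eq_iSup_isCompact]
  exact iSup_congr fun K => iSup_congr fun _ => iSup_congr fun hK => hcomp hK

/-- An even measure is determined by its values on ellipsoids centered at the origin. -/
theorem IsEvenMeasure.eq_of_ellipsoid_eq (hN : 1 ≤ N) [IsLocallyFiniteMeasure ν]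
    (hμ : IsEvenMeasure μ) (hν : IsEvenMeasure ν)
    (hgauss : ∀ b : ℝ, 0 < b → ∫⁻ x, ENNReal.ofReal (Real.exp (-b * ‖x‖ ^ 2)) ∂ν ≠ ⊤)
    (h : ∀ (g : Matrix.SpecialLinearGroup (Fin N) ℝ) (t : ℝ), 0 < t →
      μ (ellipsoid g t) = ν (ellipsoid g t)) : μ = ν := by
  have hνfin : IsFiniteMeasure (ν.withDensity gaussianWeight) := by
    refine isFiniteMeasure_withDensity ?_
    simpa [gaussianWeight] using hgauss 1 one_pos
  -- Finiteness is transferred from ν by the Gaussian identity with Q = 1.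
  have hμfin : IsFiniteMeasure (μ.withDensity gaussianWeight) := by
    refine isFiniteMeasure_withDensity ?_
    have h1 := lintegral_exp_quadratic_eq hN h (Q := 1) Matrix.PosDef.one
    simp only [map_one, one_apply_eq_self, real_inner_self_eq_norm_sq] at h1
    simp only [gaussianWeight]
    rw [h1]
    simpa using hgauss 1 one_pos
  have heq := hμ.withDensity_gaussianWeight.eq_of_map_veronese_eq hν.withDensity_gaussianWeight
    (map_veronese_withDensity_eq hN hgauss h)
  have hinv (m : Measure (EuclideanSpace ℝ (Fin N))) :
      (m.withDensity gaussianWeight).withDensity gaussianWeight⁻¹ = m :=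
    withDensity_inv_same measurable_gaussianWeight
      (Eventually.of_forall fun x => by simp [gaussianWeight, Real.exp_pos])
      (Eventually.of_forall fun x => by simp [gaussianWeight])
  rw [← hinv μ, heq, hinv ν]

end Uniqueness

/-! ### Vague limits along ultrafilters. -/

section VagueLimits

open scoped CompactlySupported

/-- Along an ultrafilter, a family of measures that is eventually bounded on compact sets converges
vaguely to a regular measure. -/
theorem exists_regular_tendsto_integral {X A : Type*} [TopologicalSpace X] [T2Space X]
    [LocallyCompactSpace X] [MeasurableSpace X] [BorelSpace X] (U : Ultrafilter A)
    (ν : A → Measure X) [∀ α, IsFiniteMeasureOnCompacts (ν α)]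
    (hbdd : ∀ K : Set X, IsCompact K → ∃ M : ℝ, ∀ᶠ α in (U : Filter A), (ν α).real K ≤ M) :
    ∃ μ : Measure X, μ.Regular ∧ ∀ f : C_c(X, ℝ),
      Tendsto (fun α => ∫ x, f x ∂(ν α)) U (𝓝 (∫ x, f x ∂μ)) := by
  have hint (f : C_c(X, ℝ)) (α : A) : Integrable f (ν α) :=
    f.continuous.integrable_of_hasCompactSupport f.hasCompactSupport
  have hex (f : C_c(X, ℝ)) : ∃ l : ℝ, Tendsto (fun α => ∫ x, f x ∂(ν α)) U (𝓝 l) := by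
    obtain ⟨M, hM⟩ := hbdd _ f.hasCompactSupport
    obtain ⟨C, hC⟩ := f.hasCompactSupport.exists_bound_of_continuous f.continuous
    have hmem : ∀ᶠ α in (U : Filter A), ∫ x, f x ∂(ν α) ∈ Metric.closedBall (0 : ℝ) (|C| * M) := by
      filter_upwards [hM] with α hα
      rw [mem_closedBall_zero_iff]
      have hK : ν α (tsupport f) < ⊤ := IsCompact.measure_lt_top f.hasCompactSupport
      rw [← setIntegral_eq_integral_of_forall_compl_eq_zero (s := tsupport f)
        fun x hx => image_eq_zero_of_notMem_tsupport hx]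
      refine (norm_setIntegral_le_of_norm_le_const hK fun x _ =>
        (hC x).trans (le_abs_self C)).trans ?_
      gcongr
    obtain ⟨l, -, hl⟩ := (isCompact_closedBall (0 : ℝ) (|C| * M)).ultrafilter_le_nhds
      (U.map fun α => ∫ x, f x ∂(ν α)) (le_principal_iff.2 hmem)
    exact ⟨l, hl⟩
  choose l hl using hex
  let Λ : C_c(X, ℝ) →ₗ[ℝ] ℝ :=
    { toFun := l
      map_add' := fun f g => by
        refine tendsto_nhds_unique (hl (f + g)) (((hl f).add (hl g)).congr fun α => ?_)
        exact (integral_add (hint f α) (hint g α)).symm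
      map_smul' := fun r f => by
        refine tendsto_nhds_unique (hl (r • f)) (((hl f).const_mul r).congr fun α => ?_)
        exact (integral_const_mul r _).symm }
  have hΛ (f : C_c(X, ℝ)) (hf : 0 ≤ f) : 0 ≤ Λ f :=
    ge_of_tendsto' (hl f) fun α => integral_nonneg hf
  refine ⟨RealRMK.rieszMeasure (PositiveLinearMap.mk₀ Λ hΛ), inferInstance, fun f => ?_⟩
  rw [RealRMK.integral_rieszMeasure]
  exact hl f

variable {N : ℕ}

/-- Carries evenness to a vague limit: a regular measure is determined by its integrals of test
functions. -/
theorem isEvenMeasure_of_integral_neg_eq {μ : Measure (EuclideanSpace ℝ (Fin N))} [μ.Regular]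
    (h : ∀ f : C_c(EuclideanSpace ℝ (Fin N), ℝ), ∫ x, f (-x) ∂μ = ∫ x, f x ∂μ) :
    IsEvenMeasure μ := by
  have : (μ.map Neg.neg).Regular := Measure.Regular.map (Homeomorph.neg _)
  have hmap : μ.map Neg.neg = μ := by
    refine Measure.ext_of_integral_eq_on_compactlySupported fun f => ?_
    rw [← h f]
    exact integral_map measurable_neg.aemeasurable f.continuous.aestronglyMeasurable
  intro V hV
  conv_rhs => rw [← hmap, Measure.map_apply measurable_neg hV]
  rfl

theorem IsEvenMeasure.integral_neg {μ : Measure (EuclideanSpace ℝ (Fin N))} (hμ : IsEvenMeasure μ)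
    {f : EuclideanSpace ℝ (Fin N) → ℝ} (hf : Continuous f) : ∫ x, f (-x) ∂μ = ∫ x, f x ∂μ := by
  conv_rhs => rw [← hμ.map_neg, integral_map (by fun_prop) hf.aestronglyMeasurable]

theorem isEvenMeasure_smul_volume (c : ENNReal) :
    IsEvenMeasure (c • (volume : Measure (EuclideanSpace ℝ (Fin N)))) := by
  intro V _
  rw [Measure.smul_apply, Measure.smul_apply, Measure.measure_neg]

theorem lintegral_exp_neg_mul_sq_norm_ne_top {b : ℝ} (hb : 0 < b) :
    ∫⁻ x : EuclideanSpace ℝ (Fin N), ENNReal.ofReal (Real.exp (-b * ‖x‖ ^ 2)) ≠ ⊤ := by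
  have h := (GaussianFourier.integrable_cexp_neg_mul_sq_norm_add (V := EuclideanSpace ℝ (Fin N))
    (b := (b : ℂ)) (by simpa using hb) 0 0).norm
  have h' : Integrable fun x : EuclideanSpace ℝ (Fin N) => Real.exp (-b * ‖x‖ ^ 2) := by
    refine h.congr (Eventually.of_forall fun x => ?_)
    simp only [zero_mul, add_zero, Complex.norm_exp]
    norm_cast
  exact (lintegral_ofReal_ne_top_iff_integrable h'.aestronglyMeasurable
    (Eventually.of_forall fun x => (Real.exp_pos _).le)).2 h'

/-- Passage to the vague limit in the measures of ellipsoids. -/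
theorem measure_ellipsoid_eq_of_tendsto {A : Type*} {l : Filter A} [l.NeBot]
    {ν : A → Measure (EuclideanSpace ℝ (Fin N))} [∀ α, IsLocallyFiniteMeasure (ν α)]
    {μ : Measure (EuclideanSpace ℝ (Fin N))} [IsLocallyFiniteMeasure μ] {c : ℝ}
    {F : Set (Matrix.SpecialLinearGroup (Fin N) ℝ × Set.Ioi (0 : ℝ))} (hF : Dense F)
    (hlim : ∀ p ∈ F, Tendsto (fun α => (ν α).real (ellipsoid p.1 (p.2 : ℝ))) l
      (𝓝 (c * (p.2 : ℝ) ^ N)))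
    (hμ : ∀ f : C_c(EuclideanSpace ℝ (Fin N), ℝ),
      Tendsto (fun α => ∫ x, f x ∂(ν α)) l (𝓝 (∫ x, f x ∂μ)))
    (g : Matrix.SpecialLinearGroup (Fin N) ℝ) {t : ℝ} (ht : 0 < t) :
    μ.real (ellipsoid g t) = c * t ^ N := by
  have hc : 0 ≤ c := by
    obtain ⟨p, hp, -⟩ := exists_ellipsoid_between hF g one_pos one_lt_two
    have hp0 : (0 : ℝ) < p.2 := p.2.2
    have := ge_of_tendsto' (hlim p hp) fun α => measureReal_nonneg
    exact nonneg_of_mul_nonneg_left this (by positivity)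
  have hbump {s r : ℝ} (hs : 0 < s) (hsr : s < r) : ∃ f : C_c(EuclideanSpace ℝ (Fin N), ℝ),
      (∀ (m : Measure (EuclideanSpace ℝ (Fin N))) [IsLocallyFiniteMeasure m],
        m.real (ellipsoid g s) ≤ ∫ x, f x ∂m ∧ ∫ x, f x ∂m ≤ m.real (ellipsoid g r)) := by
    have hr := hs.trans hsr
    obtain ⟨f, hf1, hfc, hfs, hf01⟩ := exists_continuousMap_one_of_isCompact_subset_isOpen
      (isBounded_ellipsoid g s).isCompact_closure (isOpen_ellipsoid g hr)
      (closure_ellipsoid_subset g hs hsr)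
    refine ⟨⟨f, hfc⟩, fun m _ => ?_⟩
    have hfint : Integrable f m := f.continuous.integrable_of_hasCompactSupport hfc
    have hind {r : ℝ} (hr : 0 < r) :
        Integrable ((ellipsoid g r).indicator (1 : EuclideanSpace ℝ (Fin N) → ℝ)) m ∧
          ∫ x, (ellipsoid g r).indicator (1 : EuclideanSpace ℝ (Fin N) → ℝ) x ∂m =
            m.real (ellipsoid g r) := by
      have hmeas := (isOpen_ellipsoid g hr).measurableSet
      refine ⟨(integrable_indicator_iff hmeas).2 ?_, integral_indicator_one hmeas⟩
      exact integrableOn_const (isBounded_ellipsoid g r).measure_lt_top.ne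
    rw [← (hind hs).2, ← (hind hr).2]
    refine ⟨integral_mono (hind hs).1 hfint fun x => ?_,
      integral_mono hfint (hind hr).1 fun x => ?_⟩
    · exact Set.indicator_le' (fun y hy => (hf1 (subset_closure hy)).ge)
        (fun y _ => (hf01 y).1) x
    · refine Set.le_indicator (fun y _ => (hf01 y).2) (fun y hy => ?_) x
      exact (image_eq_zero_of_notMem_tsupport fun h => hy (hfs h)).le
  have hupper {r : ℝ} (hr : t < r) : μ.real (ellipsoid g t) ≤ c * r ^ N := by
    -- The radius q leaves room for both a bump function (between t and q) and an ellipsoid of `F`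
    -- (between q and r).
    obtain ⟨q, hq1, hq2⟩ := exists_between hr
    obtain ⟨f, hf⟩ := hbump ht hq1
    obtain ⟨p, hp, hp1, hp2, hp3, hp4⟩ := exists_ellipsoid_between hF g (ht.trans hq1) hq2
    have hp0 : (0 : ℝ) < p.2 := p.2.2
    calc μ.real (ellipsoid g t) ≤ ∫ x, f x ∂μ := (hf μ).1
      _ ≤ c * (p.2 : ℝ) ^ N := le_of_tendsto_of_tendsto' (hμ f) (hlim p hp) fun α =>
          (hf (ν α)).2.trans (measureReal_mono hp3 (isBounded_ellipsoid _ _).measure_lt_top.ne)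
      _ ≤ c * r ^ N := by gcongr
  have hlower {r : ℝ} (hr0 : 0 < r) (hr : r < t) : c * r ^ N ≤ μ.real (ellipsoid g t) := by
    obtain ⟨q, hq1, hq2⟩ := exists_between hr
    obtain ⟨f, hf⟩ := hbump (hr0.trans hq1) hq2
    obtain ⟨p, hp, hp1, hp2, hp3, hp4⟩ := exists_ellipsoid_between hF g hr0 hq1
    have hp0 : (0 : ℝ) < p.2 := p.2.2
    calc c * r ^ N ≤ c * (p.2 : ℝ) ^ N := by gcongr
      _ ≤ ∫ x, f x ∂μ := le_of_tendsto_of_tendsto' (hlim p hp) (hμ f) fun α =>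
          (measureReal_mono hp4 (isBounded_ellipsoid _ _).measure_lt_top.ne).trans (hf (ν α)).1
      _ ≤ μ.real (ellipsoid g t) := (hf μ).2
  have hcont : ContinuousAt (fun r : ℝ => c * r ^ N) t := by fun_prop
  refine le_antisymm ?_ ?_
  · refine ge_of_tendsto (hcont.tendsto.mono_left nhdsWithin_le_nhds : Tendsto _ (𝓝[>] t) _) ?_
    filter_upwards [self_mem_nhdsWithin] with r hr using hupper hr
  · refine le_of_tendsto (hcont.tendsto.mono_left nhdsWithin_le_nhds : Tendsto _ (𝓝[<] t) _) ?_
    filter_upwards [Ioo_mem_nhdsLT ht] with r hr using hlower hr.1 hr.2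

/-- A net of even measures converges vaguely to a multiple of Lebesgue measure if it does so on a
dense family of ellipsoids. -/
theorem tendsto_integral_of_tendsto_ellipsoid (hN : 1 ≤ N) {A : Type*} {l : Filter A} [l.NeBot]
    {ν : A → Measure (EuclideanSpace ℝ (Fin N))} [∀ α, IsLocallyFiniteMeasure (ν α)]
    (heven : ∀ α, IsEvenMeasure (ν α)) {c : ℝ}
    {F : Set (Matrix.SpecialLinearGroup (Fin N) ℝ × Set.Ioi (0 : ℝ))} (hF : Dense F)
    (hlim : ∀ p ∈ F, Tendsto (fun α => (ν α).real (ellipsoid p.1 (p.2 : ℝ))) l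
      (𝓝 (c * (p.2 : ℝ) ^ N * (sphereArea N / N))))
    (f : C_c(EuclideanSpace ℝ (Fin N), ℝ)) :
    Tendsto (fun α => ∫ x, f x ∂(ν α)) l (𝓝 (c * ∫ x, f x)) := by
  have hc : 0 ≤ c := by
    obtain ⟨p, hp, -⟩ := exists_ellipsoid_between hF 1 one_pos one_lt_two
    have hp0 : (0 : ℝ) < p.2 := p.2.2
    have := ge_of_tendsto' (hlim p hp) fun α => measureReal_nonneg
    exact nonneg_of_mul_nonneg_left
      (nonneg_of_mul_nonneg_left this (sphereArea_div_pos hN)) (by positivity)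
  refine (tendsto_iff_ultrafilter _ _ _).2 fun U hU => ?_
  obtain ⟨μ, hμreg, hμ⟩ := exists_regular_tendsto_integral U ν fun K hK => by
    obtain ⟨R, hR, hKR⟩ := hK.isBounded.subset_ball_lt 0 0
    obtain ⟨p, hp, -, -, hp3, -⟩ := exists_ellipsoid_between hF 1 hR (lt_add_one R)
    have hKp : K ⊆ ellipsoid p.1 p.2 := fun x hx =>
      hp3 ((mem_ellipsoid_one hR).2 (mem_ball_zero_iff.1 (hKR hx)))
    refine ⟨c * (p.2 : ℝ) ^ N * (sphereArea N / N) + 1, ?_⟩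
    filter_upwards [((hlim p hp).mono_left hU).eventually_le_const (lt_add_one _)] with α hα
    exact (measureReal_mono hKp (isBounded_ellipsoid _ _).measure_lt_top.ne).trans hα
  have hμeven : IsEvenMeasure μ := by
    refine isEvenMeasure_of_integral_neg_eq fun h => ?_
    let h' : C_c(EuclideanSpace ℝ (Fin N), ℝ) :=
      ⟨⟨fun x => h (-x), by fun_prop⟩, h.hasCompactSupport.comp_homeomorph (Homeomorph.neg _)⟩
    refine tendsto_nhds_unique (hμ h') ((hμ h).congr fun α => ?_)
    exact ((heven α).integral_neg h.continuous).symm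
  have hμell (g : Matrix.SpecialLinearGroup (Fin N) ℝ) (t : ℝ) (ht : 0 < t) :
      μ (ellipsoid g t) =
        (ENNReal.ofReal c • (volume : Measure (EuclideanSpace ℝ (Fin N)))) (ellipsoid g t) := by
    have hreal := measure_ellipsoid_eq_of_tendsto (c := c * (sphereArea N / N)) hF
      (fun p hp => by
        rw [mul_right_comm]
        exact (hlim p hp).mono_left hU) hμ g ht
    -- Ellipsoids are bounded, so their mass is finite and its real value loses nothing.
    rw [Measure.smul_apply, volume_ellipsoid hN g ht, smul_eq_mul, ← ENNReal.ofReal_mul hc,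
      ← ofReal_measureReal (isBounded_ellipsoid g t).measure_lt_top.ne, hreal]
    ring_nf
  have hloc : IsLocallyFiniteMeasure
      (ENNReal.ofReal c • (volume : Measure (EuclideanSpace ℝ (Fin N)))) :=
    inferInstanceAs (IsLocallyFiniteMeasure
      (c.toNNReal • (volume : Measure (EuclideanSpace ℝ (Fin N)))))
  have hμc := hμeven.eq_of_ellipsoid_eq hN (isEvenMeasure_smul_volume (ENNReal.ofReal c))
    (fun b hb => by
      rw [lintegral_smul_measure]
      exact ENNReal.mul_ne_top ENNReal.ofReal_ne_top (lintegral_exp_neg_mul_sq_norm_ne_top hb))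
    hμell
  have := hμ f
  rwa [hμc, integral_smul_measure, ENNReal.toReal_ofReal hc, smul_eq_mul] at this

end VagueLimits

/-! ### Reduction to real and imaginary parts. -/

theorem theorem10p1 {N : ℕ} (hN : 1 ≤ N)
    {A : Type*} [Preorder A] [IsDirectedOrder A] [Nonempty A]
    (ν : A → Measure (EuclideanSpace ℝ (Fin N)))
    (hfin : ∀ α, IsLocallyFiniteMeasure (ν α))
    (heven : ∀ α, IsEvenMeasure (ν α))
    (c : ℝ)
    (F : Set (Matrix.SpecialLinearGroup (Fin N) ℝ × Set.Ioi (0 : ℝ)))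
    (hF : Dense F)
    (hlim : ∀ p ∈ F, Tendsto (fun α => (ν α).real (ellipsoid p.1 (p.2 : ℝ))) atTop
      (𝓝 (c * (p.2 : ℝ) ^ N * (sphereArea N / N))))
    {𝕜 : Type*} [RCLike 𝕜]
    (ψ : EuclideanSpace ℝ (Fin N) → 𝕜) (hψ : Continuous ψ) (hψc : HasCompactSupport ψ) :
    Tendsto (fun α => ∫ x, ψ x ∂(ν α)) atTop
      (𝓝 ((c : 𝕜) * ∫ x, ψ x)) := by
  have hint (m : Measure (EuclideanSpace ℝ (Fin N))) [IsLocallyFiniteMeasure m] :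
      Integrable ψ m := hψ.integrable_of_hasCompactSupport hψc
  have hre := tendsto_integral_of_tendsto_ellipsoid hN heven hF hlim
    ⟨⟨fun x => RCLike.re (ψ x), by fun_prop⟩, hψc.comp_left (g := RCLike.re) (map_zero _)⟩
  have him := tendsto_integral_of_tendsto_ellipsoid hN heven hF hlim
    ⟨⟨fun x => RCLike.im (ψ x), by fun_prop⟩, hψc.comp_left (g := RCLike.im) (map_zero _)⟩
  have hsum := ((RCLike.continuous_ofReal (K := 𝕜)).tendsto _ |>.comp hre).add
    (((RCLike.continuous_ofReal (K := 𝕜)).tendsto _ |>.comp him).mul_const RCLike.I)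
  have hlimit : (c : 𝕜) * ∫ x, ψ x = ((c * ∫ x, RCLike.re (ψ x) : ℝ) : 𝕜) +
      ((c * ∫ x, RCLike.im (ψ x) : ℝ) : 𝕜) * RCLike.I := by
    rw [← integral_re_add_im (hint volume)]
    push_cast
    ring
  rw [hlimit]
  exact hsum.congr fun α => integral_re_add_im (hint (ν α))
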